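/- Let $m\ge 0$, $n\ge 1$, let $\mathbb{R}^m_{>0}$ be the set of vectors in $\mathbb{R}^m$ with positive components and $\mathbb{S}^n$ the space of real symmetric $n\times n$ matrices. For $X,Y\in\mathbb{S}^n$ with $Y$ positive definite, a generalized eigenvalue of $(X,Y)$ is a number $\lambda\in\mathbb{R}$ with $Xv=\lambda Yv$ for some nonzero $v\in\mathbb{R}^n$, its multiplicity is the dimension of $\{v\in\mathbb{R}^n : Xv=\lambda Yv\}$, and $\lambda_1(X,Y)$ is the largest generalized eigenvalue. For a locally Lipschitz function $f$ on an open subset of $\mathbb{R}^m$, the Clarke subdifferential at a point $x$ of that set is $$\partial f(x)=\operatorname{conv}\Bigl\{\lim_{i\to\infty}\nabla f(x^i) \;:\; x^i\to x,\ f \text{ differentiable at each } x^i\Bigr\},$$ where only sequences for which the limit of the gradients exists are considered. Let $A,B:\mathbb{R}^m_{>0}\to\mathbb{S}^n$ be continuously differentiable with $B(y)\succ 0$ for every $y\in\mathbb{R}^m_{>0}$, and put $\lambda_1^{A,B}(y)=\lambda_1(A(y),B(y))$. Then $\lambda_1^{A,B}$ is locally Lipschitz on $\mathbb{R}^m_{>0}$.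 Moreover, let $x\in\mathbb{R}^m_{>0}$, let $t$ be the multiplicity of the maximum generalized eigenvalue $\lambda_1^{A,B}(x)$ of $(A(x),B(x))$, and let $V=[v_1,\dots,v_t]\in\mathbb{R}^{n\times t}$ be any matrix whose columns are corresponding generalized eigenvectors, i.e. $A(x)v_k=\lambda_1^{A,B}(x)B(x)v_k$ for $k=1,\dots,t$, with $V^{\mathrm T}B(x)V=I$. Then $$\partial\lambda_1^{A,B}(x)=\left\{\left[\left\langle U,\;V^{\mathrm T}\left(\frac{\partial A(x)}{\partial x_e}-\lambda_1^{A,B}(x)\,\frac{\partial B(x)}{\partial x_e}\right)V\right\rangle\right]_{e=1}^m \;:\; U\in\Upsilon_t\right\},$$ where $\langle P,Q\rangle=\operatorname{tr}(PQ)$, $\Upsilon_t=\{U\in\mathbb{S}^t : U\succeq 0,\ \operatorname{tr}U=1\}$, and $[a_e]_{e=1}^m$ is the vector in $\mathbb{R}^m$ with components $a_e$. -/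

import Mathlib

open Filter Topology

/-- The open orthant `ℝ^m_{>0}` of vectors with positive components. -/
def posOrthant (m : ℕ) : Set (EuclideanSpace ℝ (Fin m)) :=
  {x | ∀ e, 0 < x e}

/-- `μ` is a generalized eigenvalue of the pair `(X, Y)`: `X v = μ Y v` for some nonzero `v`. -/
def IsGenEigenvalue {n : ℕ} (X Y : Matrix (Fin n) (Fin n) ℝ) (μ : ℝ) : Prop :=
  ∃ v : Fin n → ℝ, v ≠ 0 ∧ X.mulVec v = μ • Y.mulVec v

/-- The maximum generalized eigenvalue `λ₁(X, Y)`. For symmetric `X`, positive definite `Y` and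
`n ≥ 1`, the set of generalized eigenvalues is finite and nonempty, so this is its maximum. -/
noncomputable def maxGenEigenvalue {n : ℕ} (X Y : Matrix (Fin n) (Fin n) ℝ) : ℝ :=
  sSup {μ : ℝ | IsGenEigenvalue X Y μ}

/-- The multiplicity of `μ` as a generalized eigenvalue of `(X, Y)`: the dimension of
`{v | X v = μ Y v}`. -/
noncomputable def genEigenvalueMultiplicity {n : ℕ} (X Y : Matrix (Fin n) (Fin n) ℝ) (μ : ℝ) : ℕ :=
  Module.finrank ℝ (LinearMap.ker (Matrix.mulVecLin (X - μ • Y)))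

/-- The function `x ↦ λ₁(A(x), B(x))`. -/
noncomputable def maxGenEigenvalueFun {m n : ℕ}
    (A B : EuclideanSpace ℝ (Fin m) → Matrix (Fin n) (Fin n) ℝ) :
    EuclideanSpace ℝ (Fin m) → ℝ :=
  fun x => maxGenEigenvalue (A x) (B x)

/-- A matrix-valued map is `C¹` on a set if all its entries are. -/
def MatrixC1On {m n : ℕ} (A : EuclideanSpace ℝ (Fin m) → Matrix (Fin n) (Fin n) ℝ)
    (Ω : Set (EuclideanSpace ℝ (Fin m))) : Prop :=
  ∀ i j, ContDiffOn ℝ 1 (fun x => A x i j) Ω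

/-- The (entrywise) partial derivative `∂A(x)/∂x_e` of a matrix-valued map. -/
noncomputable def matrixPartialDeriv {m n : ℕ}
    (A : EuclideanSpace ℝ (Fin m) → Matrix (Fin n) (Fin n) ℝ)
    (x : EuclideanSpace ℝ (Fin m)) (e : Fin m) : Matrix (Fin n) (Fin n) ℝ :=
  Matrix.of fun i j => lineDeriv ℝ (fun y => A y i j) x (EuclideanSpace.single e 1)

/-- The spectraplex `Υ_t`: symmetric positive semidefinite `t × t` matrices of trace one. -/
def spectraplex (t : ℕ) : Set (Matrix (Fin t) (Fin t) ℝ) :=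
  {U | U.PosSemidef ∧ U.trace = 1}

/-- The Clarke subdifferential at `x` of a function `f` that is locally Lipschitz near `x`: the
convex hull of all limits of gradients of `f` along sequences of points of differentiability
tending to `x`. It depends only on the values of `f` near `x`. -/
noncomputable def clarkeSubdifferential {m : ℕ} (f : EuclideanSpace ℝ (Fin m) → ℝ)
    (x : EuclideanSpace ℝ (Fin m)) : Set (EuclideanSpace ℝ (Fin m)) :=
  convexHull ℝ {g | ∃ u : ℕ → EuclideanSpace ℝ (Fin m),
    (∀ i, DifferentiableAt ℝ f (u i)) ∧ Tendsto u atTop (𝓝 x) ∧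
      Tendsto (fun i => gradient f (u i)) atTop (𝓝 g)}

/-! The largest generalized eigenvalue is the maximum over `v` of the Rayleigh quotient `v ⬝ᵥ A y *ᵥ
v / v ⬝ᵥ B y *ᵥ v`, and by homogeneity `v` may be restricted to a compact sphere. It is thus a
maximum of functions whose derivatives in `y` are continuous in `(y, v)`. Such a maximum is locally
Lipschitz (`locallyLipschitzOn_of_max`), and its Clarke subdifferential is the convex hull of the
gradients of the active branches (`clarkeSubdifferential_max`). One inclusion holds because wherever
the maximum is differentiable its gradient is that of every active branch, and active parameters
have active limits. For the other, a missing active gradient would be strictly separated by some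
direction `d`; but points of differentiability approaching `x` along `d`, supplied by Rademacher's
theorem, yield a limiting gradient at least as large in that direction
(`exists_limitingGradient_ge`).

At `x` the active `v` are the eigenvectors `c • V *ᵥ w` with `w ⬝ᵥ w = 1`. The gradient there
depends only on `vecMulVec w w`, and linearly (`genRayleighFDeriv_single`). The hull of these
rank-one matrices is the spectraplex (`spectraplex_eq_convexHull`). -/

/-- In a finite-dimensional space, the convex hull of a compact set is compact. -/
theorem IsCompact.convexHull_of_finiteDimensional {E : Type*} [NormedAddCommGroup E]
    [NormedSpace ℝ E] [FiniteDimensional ℝ E] {s : Set E} (hs : IsCompact s) :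
    IsCompact (convexHull ℝ s) := by
  -- Carathéodory: at most `finrank + 1` affinely independent points are needed, so the hull is a
  -- finite union of continuous images of compact sets.
  have key : convexHull ℝ s = ⋃ k ∈ Finset.range (Module.finrank ℝ E + 2),
      (fun p : (Fin k → ℝ) × (Fin k → E) => ∑ i, p.1 i • p.2 i) ''
        (stdSimplex ℝ (Fin k) ×ˢ Set.univ.pi fun _ => s) := by
    apply Set.Subset.antisymm
    · intro y hy
      obtain ⟨ι, _, z, w, hz, hind, hw, hw1, hsum⟩ := eq_pos_convex_span_of_mem_convexHull hy
      have hcard := hind.card_le_finrank_succ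
      have hle : Module.finrank ℝ (vectorSpan ℝ (Set.range z)) ≤ Module.finrank ℝ E :=
        Submodule.finrank_le _
      let e := Fintype.equivFin ι
      refine Set.mem_biUnion (x := Fintype.card ι) (by simp; omega)
        ⟨(w ∘ e.symm, z ∘ e.symm), ⟨⟨fun i => (hw _).le, ?_⟩, fun i _ => hz ⟨_, rfl⟩⟩, ?_⟩
      · rw [← hw1]; exact e.symm.sum_comp w
      · rw [← hsum]; exact e.symm.sum_comp fun i => w i • z i
    · refine Set.iUnion₂_subset ?_
      rintro k - _ ⟨p, ⟨hp1, hp2⟩, rfl⟩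
      exact (convex_convexHull ℝ s).sum_mem (fun i _ => hp1.1 i) hp1.2
        fun i _ => subset_convexHull ℝ s (hp2 i trivial)
  rw [key]
  refine Finset.isCompact_biUnion _ fun k _ => ?_
  refine ((isCompact_stdSimplex ℝ (Fin k)).prod (isCompact_univ_pi fun _ => hs)).image ?_
  fun_prop

/-! ### Maxima of smooth functions over a compact parameter set -/

section MaxFunction

variable {E P : Type*} [NormedAddCommGroup E] {Ω : Set E} {K : Set P} {φ : E → P → ℝ} {f : E → ℝ}

/-- Limits of active parameters are active, along a subsequence. -/
theorem exists_subseq_tendsto_active [MetricSpace P] (hΩ : IsOpen Ω) (hK : IsCompact K)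
    (hφc : ContinuousOn (fun p : E × P => φ p.1 p.2) (Ω ×ˢ K)) (hfc : ContinuousOn f Ω)
    {x : E} (hx : x ∈ Ω) {u : ℕ → E} (hu : Tendsto u atTop (𝓝 x)) (huΩ : ∀ i, u i ∈ Ω)
    {w : ℕ → P} (hw : ∀ i, w i ∈ K) (hact : ∀ i, φ (u i) (w i) = f (u i)) :
    ∃ v ∈ K, φ x v = f x ∧ ∃ k : ℕ → ℕ, StrictMono k ∧
      Tendsto (fun i => (u (k i), w (k i))) atTop (𝓝[Ω ×ˢ K] (x, v)) := by
  obtain ⟨v, hv, k, hk, hlim⟩ := hK.tendsto_subseq hw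
  have hpair : Tendsto (fun i => (u (k i), w (k i))) atTop (𝓝[Ω ×ˢ K] (x, v)) :=
    tendsto_nhdsWithin_iff.2 ⟨(hu.comp hk.tendsto_atTop).prodMk_nhds hlim,
      Eventually.of_forall fun i => ⟨huΩ _, hw _⟩⟩
  refine ⟨v, hv, ?_, k, hk, hpair⟩
  have h1 : Tendsto (fun i => φ (u (k i)) (w (k i))) atTop (𝓝 (φ x v)) :=
    (hφc (x, v) ⟨hx, hv⟩).tendsto.comp hpair
  have h2 : Tendsto (fun i => f (u (k i))) atTop (𝓝 (f x)) :=
    ((hfc.continuousAt (hΩ.mem_nhds hx)).tendsto.comp hu).comp hk.tendsto_atTop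
  simp only [hact] at h1
  exact tendsto_nhds_unique h1 h2

variable [InnerProductSpace ℝ E] {F : E → P → (E →L[ℝ] ℝ)}

/-- Where a maximum function is differentiable, its derivative is that of any active branch. -/
theorem fderiv_eq_of_active (hΩ : IsOpen Ω)
    (hφ : ∀ y ∈ Ω, ∀ v ∈ K, HasFDerivAt (fun z => φ z v) (F y v) y)
    (hle : ∀ y ∈ Ω, ∀ v ∈ K, φ y v ≤ f y) {u : E} (hu : u ∈ Ω) {v : P} (hv : v ∈ K)
    (huv : φ u v = f u) (hd : DifferentiableAt ℝ f u) : fderiv ℝ f u = F u v := by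
  -- The difference is nonnegative near `u` and vanishes at `u`.
  have hmin : IsLocalMin (fun z => f z - φ z v) u := by
    filter_upwards [hΩ.mem_nhds hu] with z hz
    have := hle z hz v hv
    simp only [huv, sub_self]; linarith
  have := hmin.hasFDerivAt_eq_zero (hd.hasFDerivAt.sub (hφ u hu v hv))
  exact sub_eq_zero.1 this

variable [FiniteDimensional ℝ E] [MetricSpace P]

/-- A maximum, over a compact set of parameters, of functions whose derivatives are jointly
continuous, is locally Lipschitz. -/
theorem locallyLipschitzOn_of_max (hΩ : IsOpen Ω) (hK : IsCompact K)
    (hφ : ∀ y ∈ Ω, ∀ v ∈ K, HasFDerivAt (fun z => φ z v) (F y v) y)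
    (hF : ContinuousOn (fun p : E × P => F p.1 p.2) (Ω ×ˢ K))
    (hmax : ∀ y ∈ Ω, ∃ v ∈ K, φ y v = f y) (hle : ∀ y ∈ Ω, ∀ v ∈ K, φ y v ≤ f y) :
    LocallyLipschitzOn Ω f := by
  intro x hx
  obtain ⟨r, hr, hball⟩ := Metric.nhds_basis_closedBall.mem_iff.1 (hΩ.mem_nhds hx)
  obtain ⟨C, hC⟩ := ((isCompact_closedBall x r).prod hK).exists_bound_of_continuousOn
    (hF.mono (Set.prod_mono hball le_rfl))
  -- With `v` active at `y`, `f y - f z ≤ φ y v - φ z v`; the mean value inequality applies with a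
  -- bound `C` common to all `v`.
  have key : ∀ y ∈ Metric.closedBall x r, ∀ z ∈ Metric.closedBall x r,
      f y - f z ≤ C * ‖y - z‖ := by
    intro y hy z hz
    obtain ⟨v, hv, hvy⟩ := hmax y (hball hy)
    have h1 := hle z (hball hz) v hv
    have h2 := (convex_closedBall x r).norm_image_sub_le_of_norm_hasFDerivWithin_le
      (fun u hu => (hφ u (hball hu) v hv).hasFDerivWithinAt) (fun u hu => hC (u, v) ⟨hu, hv⟩) hz hy
    have h3 := (le_abs_self _).trans h2
    linarith
  refine ⟨C.toNNReal, Metric.closedBall x r,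
    mem_nhdsWithin_of_mem_nhds (Metric.closedBall_mem_nhds x hr),
    LipschitzOnWith.of_dist_le_mul fun y hy z hz => ?_⟩
  have hCC : C ≤ C.toNNReal := Real.le_coe_toNNReal C
  rw [Real.dist_eq, dist_eq_norm]
  refine (abs_sub_le_iff.2 ⟨key y hy z hz, ?_⟩).trans
    (mul_le_mul_of_nonneg_right hCC (norm_nonneg _))
  rw [norm_sub_rev]; exact key z hz y hy

/-- A locally Lipschitz function is differentiable on a dense subset. -/
theorem LocallyLipschitzOn.exists_differentiableAt_near (hΩ : IsOpen Ω)
    (hf : LocallyLipschitzOn Ω f) {x : E} (hx : x ∈ Ω) {ε : ℝ} (hε : 0 < ε) :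
    ∃ y ∈ Ω, dist y x < ε ∧ DifferentiableAt ℝ f y := by
  borelize E
  obtain ⟨C, s, hs, hlip⟩ := hf hx
  rw [hΩ.nhdsWithin_eq hx] at hs
  obtain ⟨r, hr, hball⟩ := Metric.mem_nhds_iff.1
    (inter_mem (inter_mem hs (hΩ.mem_nhds hx)) (Metric.ball_mem_nhds x hε))
  -- Rademacher's theorem; a set of full measure is dense.
  have hae := (hlip.mono fun y hy => (hball hy).1.1).ae_differentiableWithinAt_of_mem
    (μ := MeasureTheory.volume)
  obtain ⟨y, hy, hyd⟩ := (MeasureTheory.Measure.dense_of_ae hae).exists_mem_open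
    (Metric.isOpen_ball (x := x) (ε := r)) ⟨x, Metric.mem_ball_self hr⟩
  exact ⟨y, (hball hyd).1.2, (hball hyd).2,
    (hy hyd).differentiableAt (Metric.isOpen_ball.mem_nhds hyd)⟩

/-- First-order expansion of the branches, uniform in the parameter. -/
theorem uniform_first_order (hΩ : IsOpen Ω) (hK : IsCompact K)
    (hφ : ∀ y ∈ Ω, ∀ v ∈ K, HasFDerivAt (fun z => φ z v) (F y v) y)
    (hF : ContinuousOn (fun p : E × P => F p.1 p.2) (Ω ×ˢ K)) {x : E} (hx : x ∈ Ω)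
    {ε : ℝ} (hε : 0 < ε) :
    ∀ᶠ u in 𝓝 x, ∀ v ∈ K, |φ u v - φ x v - F x v (u - x)| ≤ ε * ‖u - x‖ := by
  obtain ⟨r, hr, hball⟩ := Metric.nhds_basis_closedBall.mem_iff.1 (hΩ.mem_nhds hx)
  -- Uniform continuity on the compact product gives one `δ` for all `v`, within which `F y v` stays
  -- `ε`-close to `F x v`.
  have huc := Metric.uniformContinuousOn_iff.1
    (((isCompact_closedBall x r).prod hK).uniformContinuousOn_of_continuous
    (hF.mono (Set.prod_mono hball le_rfl))) ε hε
  obtain ⟨δ, hδ, h⟩ := huc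
  filter_upwards [Metric.ball_mem_nhds x (lt_min hδ hr)] with u hu v hv
  have hsub : ∀ y ∈ Metric.ball x (min δ r), y ∈ Metric.closedBall x r := fun y hy =>
    Metric.ball_subset_closedBall (Metric.ball_subset_ball (min_le_right _ _) hy)
  refine (convex_ball x (min δ r)).norm_image_sub_le_of_norm_hasFDerivWithin_le'
    (fun y hy => (hφ y (hball (hsub y hy)) v hv).hasFDerivWithinAt) (fun y hy => ?_)
    (Metric.mem_ball_self (lt_min hδ hr)) hu
  have hxm : x ∈ Metric.closedBall x r := Metric.mem_closedBall_self hr.le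
  have := h (y, v) ⟨hsub y hy, hv⟩ (x, v) ⟨hxm, hv⟩ (by
    rw [Prod.dist_eq, dist_self, max_eq_left dist_nonneg]
    exact lt_of_lt_of_le hy (min_le_left _ _))
  rw [dist_eq_norm] at this
  exact this.le

end MaxFunction

/-! ### Clarke subdifferential of a maximum function -/

section ClarkeMaxFunction

variable {m : ℕ} {P : Type*} [MetricSpace P] {Ω : Set (EuclideanSpace ℝ (Fin m))} {K : Set P}
  {φ : EuclideanSpace ℝ (Fin m) → P → ℝ}
  {F : EuclideanSpace ℝ (Fin m) → P → (EuclideanSpace ℝ (Fin m) →L[ℝ] ℝ)}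
  {f : EuclideanSpace ℝ (Fin m) → ℝ}

/-- The set of limits of gradients of `f` along sequences tending to `x`. -/
def limitingGradients (f : EuclideanSpace ℝ (Fin m) → ℝ) (x : EuclideanSpace ℝ (Fin m)) :
    Set (EuclideanSpace ℝ (Fin m)) :=
  {g | ∃ u : ℕ → EuclideanSpace ℝ (Fin m),
    (∀ i, DifferentiableAt ℝ f (u i)) ∧ Tendsto u atTop (𝓝 x) ∧
      Tendsto (fun i => gradient f (u i)) atTop (𝓝 g)}

/-- The set is the slice over `x` of the closure of the graph of the gradient. Closedness makes the
set compact, hence its hull closed, as strict separation requires. -/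
theorem isClosed_limitingGradients (f : EuclideanSpace ℝ (Fin m) → ℝ)
    (x : EuclideanSpace ℝ (Fin m)) : IsClosed (limitingGradients f x) := by
  have : limitingGradients f x = (fun g => (x, g)) ⁻¹'
      closure ((fun u => (u, gradient f u)) '' {u | DifferentiableAt ℝ f u}) := by
    ext g
    rw [Set.mem_preimage, mem_closure_iff_seq_limit]
    constructor
    · rintro ⟨u, hd, hu, hg⟩
      exact ⟨fun i => (u i, gradient f (u i)), fun i => ⟨u i, hd i, rfl⟩, hu.prodMk_nhds hg⟩
    · rintro ⟨p, hp, hlim⟩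
      choose u hd hu using hp
      have hpu : p = fun i => (u i, gradient f (u i)) := funext fun i => (hu i).symm
      subst hpu
      exact ⟨u, hd, (continuous_fst.tendsto _).comp hlim, (continuous_snd.tendsto _).comp hlim⟩
  rw [this]
  exact isClosed_closure.preimage (by fun_prop)

/-- Along the sequence each gradient is that of an active branch; compactness of `K` and joint
continuity of `F` pass this to the limit. -/
theorem limitingGradients_subset (hΩ : IsOpen Ω) (hK : IsCompact K)
    (hφ : ∀ y ∈ Ω, ∀ v ∈ K, HasFDerivAt (fun z => φ z v) (F y v) y)
    (hφc : ContinuousOn (fun p : EuclideanSpace ℝ (Fin m) × P => φ p.1 p.2) (Ω ×ˢ K))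
    (hF : ContinuousOn (fun p : EuclideanSpace ℝ (Fin m) × P => F p.1 p.2) (Ω ×ˢ K))
    (hmax : ∀ y ∈ Ω, ∃ v ∈ K, φ y v = f y) (hle : ∀ y ∈ Ω, ∀ v ∈ K, φ y v ≤ f y)
    {x : EuclideanSpace ℝ (Fin m)} (hx : x ∈ Ω) :
    limitingGradients f x ⊆
      (fun v => (InnerProductSpace.toDual ℝ _).symm (F x v)) '' {v ∈ K | φ x v = f x} := by
  rintro g ⟨u', hd', hu', hg'⟩
  obtain ⟨N, hN⟩ := eventually_atTop.1 (hu'.eventually (hΩ.mem_nhds hx))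
  let u := fun i => u' (i + N)
  have hu : Tendsto u atTop (𝓝 x) := hu'.comp (tendsto_add_atTop_nat N)
  have hg : Tendsto (fun i => gradient f (u i)) atTop (𝓝 g) :=
    hg'.comp (tendsto_add_atTop_nat N)
  have huΩ : ∀ i, u i ∈ Ω := fun i => hN _ (by omega)
  choose w hw hact using fun i => hmax (u i) (huΩ i)
  have hfc := (locallyLipschitzOn_of_max hΩ hK hφ hF hmax hle).continuousOn
  obtain ⟨v, hv, hxv, k, hk, hpair⟩ :=
    exists_subseq_tendsto_active hΩ hK hφc hfc hx hu huΩ hw hact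
  refine ⟨v, ⟨hv, hxv⟩, ?_⟩
  have h1 : Tendsto (fun i => F (u (k i)) (w (k i))) atTop (𝓝 (F x v)) :=
    (hF (x, v) ⟨hx, hv⟩).tendsto.comp hpair
  have h2 := ((InnerProductSpace.toDual ℝ (EuclideanSpace ℝ (Fin m))).symm.continuous.tendsto
    _).comp h1
  refine tendsto_nhds_unique h2 ((hg.comp hk.tendsto_atTop).congr fun i => ?_)
  simp only [Function.comp, gradient]
  rw [fderiv_eq_of_active hΩ hφ hle (huΩ _) (hw _) (hact _) (hd' _)]

/-- In every direction, each active branch is dominated by some limiting gradient. -/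
theorem exists_limitingGradient_ge (hΩ : IsOpen Ω) (hK : IsCompact K)
    (hφ : ∀ y ∈ Ω, ∀ v ∈ K, HasFDerivAt (fun z => φ z v) (F y v) y)
    (hφc : ContinuousOn (fun p : EuclideanSpace ℝ (Fin m) × P => φ p.1 p.2) (Ω ×ˢ K))
    (hF : ContinuousOn (fun p : EuclideanSpace ℝ (Fin m) × P => F p.1 p.2) (Ω ×ˢ K))
    (hmax : ∀ y ∈ Ω, ∃ v ∈ K, φ y v = f y) (hle : ∀ y ∈ Ω, ∀ v ∈ K, φ y v ≤ f y)
    {x : EuclideanSpace ℝ (Fin m)} (hx : x ∈ Ω) {v₀ : P} (hv₀ : v₀ ∈ K) (hact₀ : φ x v₀ = f x)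
    (d : EuclideanSpace ℝ (Fin m)) :
    ∃ g ∈ limitingGradients f x, F x v₀ d ≤ inner ℝ g d := by
  have hlip := locallyLipschitzOn_of_max hΩ hK hφ hF hmax hle
  have hs0 : Tendsto (fun i : ℕ => (1 : ℝ) / (i + 1)) atTop (𝓝 0) :=
    tendsto_one_div_add_atTop_nhds_zero_nat
  have hy0 : Tendsto (fun i : ℕ => x + ((1 : ℝ) / (i + 1)) • d) atTop (𝓝 x) := by
    simpa using tendsto_const_nhds.add (hs0.smul_const d)
  obtain ⟨N, hN⟩ := eventually_atTop.1 (hy0.eventually (hΩ.mem_nhds hx))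
  let s : ℕ → ℝ := fun i => 1 / ((i + N : ℕ) + 1)
  have hs : Tendsto s atTop (𝓝 0) := hs0.comp (tendsto_add_atTop_nat N)
  have hspos : ∀ i, 0 < s i := fun i => by positivity
  have hy : ∀ i, x + s i • d ∈ Ω := fun i => hN (i + N) (by omega)
  -- The error `s i ^ 2` is negligible against the step `s i`, so `(u i - x) / s i` still tends to
  -- `d`.
  choose u huΩ hdist hdiff using fun i =>
    hlip.exists_differentiableAt_near hΩ (hy i) (pow_pos (hspos i) 2)
  have hq : Tendsto (fun i => (s i)⁻¹ • (u i - x)) atTop (𝓝 d) := by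
    rw [tendsto_iff_dist_tendsto_zero]
    refine squeeze_zero (fun _ => dist_nonneg) (fun i => ?_) hs
    have h1 : (s i)⁻¹ • (u i - x) - d = (s i)⁻¹ • (u i - (x + s i • d)) := by
      rw [← sub_sub, smul_sub _ (u i - x), smul_smul, inv_mul_cancel₀ (hspos i).ne', one_smul]
    rw [dist_eq_norm, h1, norm_smul, norm_inv, Real.norm_of_nonneg (hspos i).le, ← dist_eq_norm,
      inv_mul_le_iff₀ (hspos i), ← sq]
    exact (hdist i).le
  have hu : Tendsto u atTop (𝓝 x) := by
    have h1 : Tendsto (fun i => x + s i • ((s i)⁻¹ • (u i - x))) atTop (𝓝 (x + (0 : ℝ) • d)) :=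
      tendsto_const_nhds.add (hs.smul hq)
    rw [zero_smul, add_zero] at h1
    refine h1.congr fun i => ?_
    rw [smul_smul, mul_inv_cancel₀ (hspos i).ne', one_smul, add_sub_cancel]
  choose w hw hact using fun i => hmax (u i) (huΩ i)
  obtain ⟨v, hv, hxv, k, hk, hpair⟩ :=
    exists_subseq_tendsto_active hΩ hK hφc hlip.continuousOn hx hu huΩ hw hact
  have hFlim : Tendsto (fun i => F (u (k i)) (w (k i))) atTop (𝓝 (F x v)) :=
    (hF (x, v) ⟨hx, hv⟩).tendsto.comp hpair
  refine ⟨(InnerProductSpace.toDual ℝ _).symm (F x v), ⟨u ∘ k, fun i => hdiff _,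
    hu.comp hk.tendsto_atTop, ?_⟩, ?_⟩
  · refine (((InnerProductSpace.toDual ℝ
      (EuclideanSpace ℝ (Fin m))).symm.continuous.tendsto _).comp hFlim).congr fun i => ?_
    simp only [Function.comp, gradient]
    rw [fderiv_eq_of_active hΩ hφ hle (huΩ _) (hw _) (hact _) (hdiff _)]
  rw [InnerProductSpace.toDual_symm_apply]
  have hFxlim : Tendsto (fun i => F x (w (k i))) atTop (𝓝 (F x v)) :=
    (hF (x, v) ⟨hx, hv⟩).tendsto.comp (tendsto_nhdsWithin_iff.2
      ⟨tendsto_const_nhds.prodMk_nhds ((continuous_snd.tendsto _).comp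
        (tendsto_nhdsWithin_iff.1 hpair).1), Eventually.of_forall fun i => ⟨hx, hw _⟩⟩)
  have hqk := hq.comp hk.tendsto_atTop
  -- With `w` active at `u`: `φ u v₀ ≤ f u = φ u w` and `φ x w ≤ f x = φ x v₀`. Expanding both
  -- branches at `x` with uniform error `ε * ‖u - x‖`, dividing by the step and passing to the limit
  -- gives the claim.
  have main : ∀ ε > 0, F x v₀ d - ε * ‖d‖ ≤ F x v d + ε * ‖d‖ := by
    intro ε hε
    have hL : Tendsto (fun i => F x v₀ ((s (k i))⁻¹ • (u (k i) - x)) -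
        ε * ‖(s (k i))⁻¹ • (u (k i) - x)‖) atTop (𝓝 (F x v₀ d - ε * ‖d‖)) :=
      (((F x v₀).continuous.tendsto d).comp hqk).sub (hqk.norm.const_mul ε)
    have hR : Tendsto (fun i => F x (w (k i)) ((s (k i))⁻¹ • (u (k i) - x)) +
        ε * ‖(s (k i))⁻¹ • (u (k i) - x)‖) atTop (𝓝 (F x v d + ε * ‖d‖)) :=
      ((isBoundedBilinearMap_apply.continuous.tendsto (F x v, d)).comp
        (hFxlim.prodMk_nhds hqk)).add (hqk.norm.const_mul ε)
    refine le_of_tendsto_of_tendsto hL hR ?_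
    filter_upwards [(hu.comp hk.tendsto_atTop).eventually
      (uniform_first_order hΩ hK hφ hF hx hε)] with i hi
    have h1 := abs_le.1 (hi v₀ hv₀)
    have h2 := abs_le.1 (hi (w (k i)) (hw _))
    have h3 := hle (u (k i)) (huΩ _) v₀ hv₀
    have h4 := hle x hx (w (k i)) (hw _)
    have h5 := hact (k i)
    simp only [Function.comp] at h1 h2
    have h6 : F x v₀ (u (k i) - x) - ε * ‖u (k i) - x‖ ≤
        F x (w (k i)) (u (k i) - x) + ε * ‖u (k i) - x‖ := by linarith [h1.1, h2.2]
    have h7 := mul_le_mul_of_nonneg_left h6 (inv_pos.2 (hspos (k i))).le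
    simp only [map_smul, smul_eq_mul, norm_smul, norm_inv, Real.norm_of_nonneg (hspos (k i)).le]
    linarith
  have hlimL : Tendsto (fun ε : ℝ => F x v₀ d - ε * ‖d‖) (𝓝[>] 0) (𝓝 (F x v₀ d)) := by
    have : Tendsto (fun ε : ℝ => F x v₀ d - ε * ‖d‖) (𝓝 0) (𝓝 (F x v₀ d - 0 * ‖d‖)) :=
      Continuous.tendsto (by fun_prop) 0
    rw [zero_mul, sub_zero] at this
    exact this.mono_left nhdsWithin_le_nhds
  have hlimR : Tendsto (fun ε : ℝ => F x v d + ε * ‖d‖) (𝓝[>] 0) (𝓝 (F x v d)) := by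
    have : Tendsto (fun ε : ℝ => F x v d + ε * ‖d‖) (𝓝 0) (𝓝 (F x v d + 0 * ‖d‖)) :=
      Continuous.tendsto (by fun_prop) 0
    rw [zero_mul, add_zero] at this
    exact this.mono_left nhdsWithin_le_nhds
  exact le_of_tendsto_of_tendsto hlimL hlimR
    (eventually_nhdsWithin_of_forall fun ε hε => main ε hε)

/-- The Clarke subdifferential of a maximum, over a compact set of parameters, of continuously
differentiable functions is the convex hull of the gradients of the active branches. -/
theorem clarkeSubdifferential_max (hΩ : IsOpen Ω) (hK : IsCompact K)
    (hφ : ∀ y ∈ Ω, ∀ v ∈ K, HasFDerivAt (fun z => φ z v) (F y v) y)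
    (hφc : ContinuousOn (fun p : EuclideanSpace ℝ (Fin m) × P => φ p.1 p.2) (Ω ×ˢ K))
    (hF : ContinuousOn (fun p : EuclideanSpace ℝ (Fin m) × P => F p.1 p.2) (Ω ×ˢ K))
    (hmax : ∀ y ∈ Ω, ∃ v ∈ K, φ y v = f y) (hle : ∀ y ∈ Ω, ∀ v ∈ K, φ y v ≤ f y)
    {x : EuclideanSpace ℝ (Fin m)} (hx : x ∈ Ω) :
    clarkeSubdifferential f x = convexHull ℝ
      ((fun v => (InnerProductSpace.toDual ℝ _).symm (F x v)) '' {v ∈ K | φ x v = f x}) := by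
  have hsub := limitingGradients_subset hΩ hK hφ hφc hF hmax hle hx
  change convexHull ℝ (limitingGradients f x) = _
  refine (convexHull_mono hsub).antisymm (convexHull_min ?_ (convex_convexHull ℝ _))
  rintro _ ⟨v₀, ⟨hv₀, hact₀⟩, rfl⟩
  have hFx : ContinuousOn (fun v => (InnerProductSpace.toDual ℝ
      (EuclideanSpace ℝ (Fin m))).symm (F x v)) K :=
    (InnerProductSpace.toDual ℝ (EuclideanSpace ℝ (Fin m))).symm.continuous.comp_continuousOn
      (hF.comp (f := fun v => (x, v)) (by fun_prop) fun v hv => ⟨hx, hv⟩)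
  have hcpt : IsCompact (limitingGradients f x) :=
    (hK.image_of_continuousOn hFx).of_isClosed_subset (isClosed_limitingGradients f x)
      (hsub.trans (Set.image_mono fun v hv => hv.1))
  by_contra hnot
  -- The separating functional `l`, read as a direction through the Riesz isomorphism, contradicts
  -- the domination of `F x v₀` by a limiting gradient.
  obtain ⟨l, c, hl, hc⟩ := geometric_hahn_banach_closed_point (convex_convexHull ℝ _)
    hcpt.convexHull_of_finiteDimensional.isClosed hnot
  obtain ⟨g, hg, hge⟩ := exists_limitingGradient_ge hΩ hK hφ hφc hF hmax hle hx hv₀ hact₀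
    ((InnerProductSpace.toDual ℝ _).symm l)
  have h1 := hl g (subset_convexHull ℝ _ hg)
  have h2 : inner ℝ g ((InnerProductSpace.toDual ℝ _).symm l) = l g := by
    rw [real_inner_comm, InnerProductSpace.toDual_symm_apply]
  have h3 : F x v₀ ((InnerProductSpace.toDual ℝ _).symm l) =
      l ((InnerProductSpace.toDual ℝ _).symm (F x v₀)) := by
    rw [← InnerProductSpace.toDual_symm_apply (𝕜 := ℝ) (y := F x v₀), real_inner_comm,
      InnerProductSpace.toDual_symm_apply]
  linarith

end ClarkeMaxFunction

/-! ### Extreme points of the spectraplex -/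

section Spectraplex

open Matrix

theorem convex_spectraplex (t : ℕ) : Convex ℝ (spectraplex t) := by
  rintro U ⟨hU, hU1⟩ W ⟨hW, hW1⟩ a b ha hb hab
  refine ⟨(hU.smul ha).add (hW.smul hb), ?_⟩
  rw [trace_add, trace_smul, trace_smul, hU1, hW1]
  simpa using hab

/-- The spectraplex is the convex hull of the rank-one projections. -/
theorem spectraplex_eq_convexHull (t : ℕ) :
    spectraplex t = convexHull ℝ ((fun w : Fin t → ℝ => vecMulVec w w) '' {w | w ⬝ᵥ w = 1}) := by
  apply Set.Subset.antisymm
  · rintro U ⟨hU, hU1⟩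
    let q : Fin t → Fin t → ℝ := fun i => hU.1.eigenvectorBasis i
    have hq : ∀ i, q i ⬝ᵥ q i = 1 := by
      intro i
      have h := hU.1.eigenvectorBasis.orthonormal.1 i
      have h2 := real_inner_self_eq_norm_sq (hU.1.eigenvectorBasis i)
      rw [h, EuclideanSpace.inner_eq_star_dotProduct] at h2
      simpa using h2
    -- Spectral decomposition; the eigenvalues are nonnegative with sum `trace U = 1`, so they serve
    -- as convex weights.
    have hsum : U = ∑ i, hU.1.eigenvalues i • vecMulVec (q i) (q i) := by
      ext a b
      have h := congrFun (congrFun hU.1.spectral_theorem a) b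
      rw [h]
      rw [Unitary.conjStarAlgAut_apply, Matrix.mul_apply, Matrix.sum_apply]
      refine Finset.sum_congr rfl fun i _ => ?_
      rw [mul_diagonal, Matrix.smul_apply, vecMulVec_apply, star_apply,
        IsHermitian.eigenvectorUnitary_apply, IsHermitian.eigenvectorUnitary_apply]
      simp only [Function.comp, RCLike.ofReal_real_eq_id, id, star_trivial, smul_eq_mul, q]
      ring
    rw [hsum]
    refine (convex_convexHull ℝ _).sum_mem (fun i _ => hU.eigenvalues_nonneg i) ?_
      fun i _ => subset_convexHull ℝ _ ⟨q i, hq i, rfl⟩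
    rw [← hU1, hU.1.trace_eq_sum_eigenvalues]
    simp
  · refine convexHull_min ?_ (convex_spectraplex t)
    rintro _ ⟨w, hw, rfl⟩
    refine ⟨by simpa using posSemidef_vecMulVec_self_star w, ?_⟩
    rw [trace_vecMulVec]; exact hw

end Spectraplex

/-! ### Variational characterization of the largest generalized eigenvalue -/

section Rayleigh

open Matrix

variable {n : ℕ}

/-- The generalized Rayleigh quotient of a pair of matrices. -/
noncomputable def genRayleigh (X Y : Matrix (Fin n) (Fin n) ℝ) (v : Fin n → ℝ) : ℝ :=
  (v ⬝ᵥ X *ᵥ v) / (v ⬝ᵥ Y *ᵥ v)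

theorem Matrix.PosDef.dotProduct_mulVec_pos_real {Y : Matrix (Fin n) (Fin n) ℝ} (hY : Y.PosDef)
    {v : Fin n → ℝ} (hv : v ≠ 0) : 0 < v ⬝ᵥ Y *ᵥ v := by
  simpa using hY.dotProduct_mulVec_pos hv

theorem genRayleigh_smul (X Y : Matrix (Fin n) (Fin n) ℝ) {c : ℝ} (hc : c ≠ 0)
    (v : Fin n → ℝ) : genRayleigh X Y (c • v) = genRayleigh X Y v := by
  simp only [genRayleigh, mulVec_smul, dotProduct_smul, smul_dotProduct, smul_eq_mul]
  rw [mul_div_mul_left _ _ hc, mul_div_mul_left _ _ hc]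

theorem genRayleigh_of_eigenvector {X Y : Matrix (Fin n) (Fin n) ℝ} (hY : Y.PosDef)
    {v : Fin n → ℝ} (hv : v ≠ 0) {μ : ℝ} (h : X *ᵥ v = μ • Y *ᵥ v) : genRayleigh X Y v = μ := by
  rw [genRayleigh, h, dotProduct_smul, smul_eq_mul,
    mul_div_cancel_right₀ _ (hY.dotProduct_mulVec_pos_real hv).ne']

/-- A maximizer of the generalized Rayleigh quotient is a generalized eigenvector. -/
theorem eigenvector_of_genRayleigh_max {X Y : Matrix (Fin n) (Fin n) ℝ} (hX : X.IsSymm)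
    (hY : Y.PosDef) {μ : ℝ} (hle : ∀ v, v ≠ 0 → genRayleigh X Y v ≤ μ) {v : Fin n → ℝ}
    (hv : v ≠ 0) (h : genRayleigh X Y v = μ) : X *ᵥ v = μ • Y *ᵥ v := by
  -- Maximality makes `μ • Y - X` positive semidefinite, and a semidefinite form vanishes only on
  -- its kernel.
  have hpsd : (μ • Y - X).PosSemidef := by
    refine .of_dotProduct_mulVec_nonneg ?_ fun w => ?_
    · have h1 : Yᵀ = Y := by simpa [IsHermitian, conjTranspose_eq_transpose_of_trivial] using (hY.1 : Yᴴ = Y)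
      have h2 : Xᵀ = X := hX
      simp [IsHermitian, h1, h2]
    · rcases eq_or_ne w 0 with rfl | hw
      · simp
      · have := (div_le_iff₀ (hY.dotProduct_mulVec_pos_real hw)).1 (hle w hw)
        simp only [star_trivial, sub_mulVec, smul_mulVec, dotProduct_sub, dotProduct_smul,
          smul_eq_mul]
        linarith
  have h0 : (μ • Y - X) *ᵥ v = 0 := by
    rw [← hpsd.dotProduct_mulVec_zero_iff]
    have := (div_eq_iff (hY.dotProduct_mulVec_pos_real hv).ne').1 h
    simp only [star_trivial, sub_mulVec, smul_mulVec, dotProduct_sub, dotProduct_smul,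
      smul_eq_mul]
    linarith
  rw [sub_mulVec, smul_mulVec, sub_eq_zero] at h0
  exact h0.symm

theorem continuousOn_genRayleigh {Y : Matrix (Fin n) (Fin n) ℝ} (hY : Y.PosDef)
    (X : Matrix (Fin n) (Fin n) ℝ) :
    ContinuousOn (genRayleigh X Y) (Metric.sphere (0 : Fin n → ℝ) 1) := by
  refine ContinuousOn.div (by fun_prop) (by fun_prop) fun v hv => ?_
  exact (hY.dotProduct_mulVec_pos_real (ne_zero_of_mem_unit_sphere ⟨v, hv⟩)).ne'

/-- Compactness gives a maximizer on the sphere, nonempty since `0 < n`; homogeneity of degree zero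
extends the bound to all nonzero vectors. -/
theorem exists_genRayleigh_max (hn : 0 < n) {X Y : Matrix (Fin n) (Fin n) ℝ} (hY : Y.PosDef) :
    ∃ v ∈ Metric.sphere (0 : Fin n → ℝ) 1,
      ∀ w, w ≠ 0 → genRayleigh X Y w ≤ genRayleigh X Y v := by
  have : Nonempty (Fin n) := ⟨⟨0, hn⟩⟩
  obtain ⟨v, hv, hmax⟩ := (isCompact_sphere (0 : Fin n → ℝ) 1).exists_isMaxOn
    (NormedSpace.sphere_nonempty.2 zero_le_one) (continuousOn_genRayleigh hY X)
  refine ⟨v, hv, fun w hw => ?_⟩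
  rw [← genRayleigh_smul X Y (inv_ne_zero (norm_ne_zero_iff.2 hw)) w]
  exact hmax (by simp [norm_smul, hw])

/-- The maximum of the Rayleigh quotient is an eigenvalue, and every eigenvalue is a value of the
quotient. Hence the `sSup` is attained rather than a default value. -/
theorem isGreatest_maxGenEigenvalue (hn : 0 < n) {X Y : Matrix (Fin n) (Fin n) ℝ}
    (hX : X.IsSymm) (hY : Y.PosDef) :
    IsGreatest {μ : ℝ | IsGenEigenvalue X Y μ} (maxGenEigenvalue X Y) := by
  obtain ⟨v, hv, hmax⟩ := exists_genRayleigh_max hn (X := X) hY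
  have hv0 : v ≠ 0 := ne_zero_of_mem_unit_sphere ⟨v, hv⟩
  have : IsGreatest {μ : ℝ | IsGenEigenvalue X Y μ} (genRayleigh X Y v) := by
    refine ⟨⟨v, hv0, eigenvector_of_genRayleigh_max hX hY hmax hv0 rfl⟩, ?_⟩
    rintro μ ⟨w, hw, hwe⟩
    rw [← genRayleigh_of_eigenvector hY hw hwe]
    exact hmax w hw
  rwa [maxGenEigenvalue, this.csSup_eq]

theorem exists_genRayleigh_eq_maxGenEigenvalue (hn : 0 < n) {X Y : Matrix (Fin n) (Fin n) ℝ}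
    (hX : X.IsSymm) (hY : Y.PosDef) :
    ∃ v ∈ Metric.sphere (0 : Fin n → ℝ) 1, genRayleigh X Y v = maxGenEigenvalue X Y := by
  obtain ⟨v, hv, hve⟩ := (isGreatest_maxGenEigenvalue hn hX hY).1
  refine ⟨‖v‖⁻¹ • v, by simp [norm_smul, hv], ?_⟩
  rw [genRayleigh_smul X Y (inv_ne_zero (norm_ne_zero_iff.2 hv))]
  exact genRayleigh_of_eigenvector hY hv hve

theorem genRayleigh_le_maxGenEigenvalue (hn : 0 < n) {X Y : Matrix (Fin n) (Fin n) ℝ}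
    (hX : X.IsSymm) (hY : Y.PosDef) {w : Fin n → ℝ} (hw : w ≠ 0) :
    genRayleigh X Y w ≤ maxGenEigenvalue X Y := by
  obtain ⟨v, hv, hmax⟩ := exists_genRayleigh_max hn (X := X) hY
  have hv0 : v ≠ 0 := ne_zero_of_mem_unit_sphere ⟨v, hv⟩
  exact (hmax w hw).trans ((isGreatest_maxGenEigenvalue hn hX hY).2
    ⟨v, hv0, eigenvector_of_genRayleigh_max hX hY hmax hv0 rfl⟩)

end Rayleigh

/-! ### Derivatives of the Rayleigh quotient in the base point -/

section Derivatives

open Matrix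

variable {m n : ℕ} {A B : EuclideanSpace ℝ (Fin m) → Matrix (Fin n) (Fin n) ℝ}
  {Ω : Set (EuclideanSpace ℝ (Fin m))}

theorem isOpen_posOrthant (m : ℕ) : IsOpen (posOrthant m) := by
  simp only [posOrthant, Set.ofPred_forall]
  exact isOpen_iInter_of_finite fun e => isOpen_lt continuous_const (by fun_prop)

/-- The derivative at `y` of the quadratic form `v ⬝ᵥ A z *ᵥ v` with respect to `z`. -/
noncomputable def quadFDeriv (A : EuclideanSpace ℝ (Fin m) → Matrix (Fin n) (Fin n) ℝ)
    (y : EuclideanSpace ℝ (Fin m)) (v : Fin n → ℝ) : EuclideanSpace ℝ (Fin m) →L[ℝ] ℝ :=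
  ∑ i, ∑ j, (v i * v j) • fderiv ℝ (fun z => A z i j) y

/-- The derivative at `y` of the generalized Rayleigh quotient `genRayleigh (A z) (B z) v`
with respect to `z`. -/
noncomputable def genRayleighFDeriv (A B : EuclideanSpace ℝ (Fin m) → Matrix (Fin n) (Fin n) ℝ)
    (y : EuclideanSpace ℝ (Fin m)) (v : Fin n → ℝ) : EuclideanSpace ℝ (Fin m) →L[ℝ] ℝ :=
  (v ⬝ᵥ B y *ᵥ v)⁻¹ • (quadFDeriv A y v - genRayleigh (A y) (B y) v • quadFDeriv B y v)

theorem dotProduct_mulVec_eq_sum (X : Matrix (Fin n) (Fin n) ℝ) (v : Fin n → ℝ) :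
    v ⬝ᵥ X *ᵥ v = ∑ i, ∑ j, v i * v j * X i j := by
  simp only [dotProduct, mulVec, Finset.mul_sum]
  exact Finset.sum_congr rfl fun i _ => Finset.sum_congr rfl fun j _ => by ring

theorem MatrixC1On.differentiableAt (hA : MatrixC1On A Ω) (hΩ : IsOpen Ω)
    {y : EuclideanSpace ℝ (Fin m)} (hy : y ∈ Ω) (i j : Fin n) :
    DifferentiableAt ℝ (fun z => A z i j) y :=
  ((hA i j).differentiableOn one_ne_zero).differentiableAt (hΩ.mem_nhds hy)

theorem MatrixC1On.hasFDerivAt_quad (hA : MatrixC1On A Ω) (hΩ : IsOpen Ω)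
    {y : EuclideanSpace ℝ (Fin m)} (hy : y ∈ Ω) (v : Fin n → ℝ) :
    HasFDerivAt (fun z => v ⬝ᵥ A z *ᵥ v) (quadFDeriv A y v) y := by
  simp only [dotProduct_mulVec_eq_sum]
  exact HasFDerivAt.fun_sum fun i _ => HasFDerivAt.fun_sum fun j _ =>
    (hA.differentiableAt hΩ hy i j).hasFDerivAt.const_mul (v i * v j)

theorem MatrixC1On.continuousOn_quad (hA : MatrixC1On A Ω) (K : Set (Fin n → ℝ)) :
    ContinuousOn (fun p : EuclideanSpace ℝ (Fin m) × (Fin n → ℝ) => p.2 ⬝ᵥ A p.1 *ᵥ p.2)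
      (Ω ×ˢ K) := by
  simp only [dotProduct_mulVec_eq_sum]
  refine continuousOn_finsetSum _ fun i _ => continuousOn_finsetSum _ fun j _ => ?_
  exact ContinuousOn.mul (by fun_prop)
    ((hA i j).continuousOn.comp continuousOn_fst fun p hp => hp.1)

theorem MatrixC1On.continuousOn_quadFDeriv (hA : MatrixC1On A Ω) (hΩ : IsOpen Ω)
    (K : Set (Fin n → ℝ)) :
    ContinuousOn (fun p : EuclideanSpace ℝ (Fin m) × (Fin n → ℝ) => quadFDeriv A p.1 p.2)
      (Ω ×ˢ K) := by
  refine continuousOn_finsetSum _ fun i _ => continuousOn_finsetSum _ fun j _ => ?_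
  have h1 : ContinuousOn (fun p : EuclideanSpace ℝ (Fin m) × (Fin n → ℝ) => p.2 i * p.2 j)
      (Ω ×ˢ K) := by fun_prop
  have h2 : ContinuousOn (fun p : EuclideanSpace ℝ (Fin m) × (Fin n → ℝ) =>
      fderiv ℝ (fun z => A z i j) p.1) (Ω ×ˢ K) :=
    ((hA i j).continuousOn_fderiv_of_isOpen hΩ le_rfl).comp continuousOn_fst fun p hp => hp.1
  exact h1.smul h2

theorem hasFDerivAt_genRayleigh (hΩ : IsOpen Ω) (hA : MatrixC1On A Ω) (hB : MatrixC1On B Ω)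
    (hBpos : ∀ y ∈ Ω, (B y).PosDef) {y : EuclideanSpace ℝ (Fin m)} (hy : y ∈ Ω)
    {v : Fin n → ℝ} (hv : v ≠ 0) :
    HasFDerivAt (fun z => genRayleigh (A z) (B z) v) (genRayleighFDeriv A B y v) y := by
  have hb := ((hBpos y hy).dotProduct_mulVec_pos_real hv).ne'
  have h := (hA.hasFDerivAt_quad hΩ hy v).mul
    ((hasDerivAt_inv hb).comp_hasFDerivAt y (hB.hasFDerivAt_quad hΩ hy v))
  refine (h.congr_fderiv ?_ : HasFDerivAt _ (genRayleighFDeriv A B y v) y)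
  ext d
  simp only [genRayleighFDeriv, genRayleigh, _root_.add_apply,
    _root_.sub_apply, _root_.smul_apply, smul_eq_mul, Function.comp]
  field_simp
  ring

theorem continuousOn_genRayleigh_prod (hA : MatrixC1On A Ω) (hB : MatrixC1On B Ω)
    (hBpos : ∀ y ∈ Ω, (B y).PosDef) :
    ContinuousOn (fun p : EuclideanSpace ℝ (Fin m) × (Fin n → ℝ) =>
      genRayleigh (A p.1) (B p.1) p.2) (Ω ×ˢ Metric.sphere (0 : Fin n → ℝ) 1) :=
  (hA.continuousOn_quad _).div (hB.continuousOn_quad _) fun p hp =>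
    ((hBpos p.1 hp.1).dotProduct_mulVec_pos_real (ne_zero_of_mem_unit_sphere ⟨p.2, hp.2⟩)).ne'

theorem continuousOn_genRayleighFDeriv (hΩ : IsOpen Ω) (hA : MatrixC1On A Ω)
    (hB : MatrixC1On B Ω) (hBpos : ∀ y ∈ Ω, (B y).PosDef) :
    ContinuousOn (fun p : EuclideanSpace ℝ (Fin m) × (Fin n → ℝ) =>
      genRayleighFDeriv A B p.1 p.2) (Ω ×ˢ Metric.sphere (0 : Fin n → ℝ) 1) := by
  have h1 := (hB.continuousOn_quad (Metric.sphere (0 : Fin n → ℝ) 1)).inv₀ fun p hp =>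
    ((hBpos p.1 hp.1).dotProduct_mulVec_pos_real (ne_zero_of_mem_unit_sphere ⟨p.2, hp.2⟩)).ne'
  exact h1.smul ((hA.continuousOn_quadFDeriv hΩ _).sub
    ((continuousOn_genRayleigh_prod hA hB hBpos).smul (hB.continuousOn_quadFDeriv hΩ _)))

theorem MatrixC1On.quadFDeriv_single (hA : MatrixC1On A Ω) (hΩ : IsOpen Ω)
    {y : EuclideanSpace ℝ (Fin m)} (hy : y ∈ Ω) (v : Fin n → ℝ) (e : Fin m) :
    quadFDeriv A y v (EuclideanSpace.single e 1) = v ⬝ᵥ matrixPartialDeriv A y e *ᵥ v := by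
  simp only [dotProduct_mulVec_eq_sum, quadFDeriv, matrixPartialDeriv, of_apply,
    _root_.sum_apply, _root_.smul_apply, smul_eq_mul]
  exact Finset.sum_congr rfl fun i _ => Finset.sum_congr rfl fun j _ => by
    rw [(hA.differentiableAt hΩ hy i j).lineDeriv_eq_fderiv]

theorem toDual_symm_apply_coord (l : EuclideanSpace ℝ (Fin m) →L[ℝ] ℝ) (e : Fin m) :
    (InnerProductSpace.toDual ℝ (EuclideanSpace ℝ (Fin m))).symm l e =
      l (EuclideanSpace.single e 1) := by
  rw [← InnerProductSpace.toDual_symm_apply (𝕜 := ℝ) (y := l), EuclideanSpace.inner_single_right]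
  simp

/-- The gradient of the Rayleigh quotient in terms of the reduced matrices, for a vector
`c • V *ᵥ w` of the eigenspace parametrized by `V`. -/
theorem genRayleighFDeriv_single {t : ℕ} (hΩ : IsOpen Ω) (hA : MatrixC1On A Ω)
    (hB : MatrixC1On B Ω) {y : EuclideanSpace ℝ (Fin m)} (hy : y ∈ Ω)
    {V : Matrix (Fin n) (Fin t) ℝ} (hV : Vᵀ * B y * V = 1) {w : Fin t → ℝ} (hw : w ⬝ᵥ w = 1)
    {c : ℝ} (hc : c ≠ 0) {μ : ℝ} (hμ : genRayleigh (A y) (B y) (c • V *ᵥ w) = μ) (e : Fin m) :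
    genRayleighFDeriv A B y (c • V *ᵥ w) (EuclideanSpace.single e 1) =
      (vecMulVec w w *
        (Vᵀ * (matrixPartialDeriv A y e - μ • matrixPartialDeriv B y e) * V)).trace := by
  have hquad : ∀ X : Matrix (Fin n) (Fin n) ℝ,
      (c • V *ᵥ w) ⬝ᵥ X *ᵥ (c • V *ᵥ w) = c ^ 2 * (w ⬝ᵥ (Vᵀ * X * V) *ᵥ w) := by
    intro X
    rw [← mulVec_mulVec, ← mulVec_mulVec, dotProduct_mulVec w, vecMul_transpose, mulVec_smul,
      dotProduct_smul, smul_dotProduct]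
    simp only [smul_eq_mul]
    ring
  have htr : ∀ M : Matrix (Fin t) (Fin t) ℝ, (vecMulVec w w * M).trace = w ⬝ᵥ M *ᵥ w := by
    intro M
    rw [trace_mul_comm, mul_vecMulVec, trace_vecMulVec, dotProduct_comm]
  -- The denominator `c ^ 2` cancels the factor `c ^ 2` of the numerator, so the gradient does not
  -- depend on the scaling.
  have hb : (c • V *ᵥ w) ⬝ᵥ B y *ᵥ (c • V *ᵥ w) = c ^ 2 := by
    rw [hquad, hV, one_mulVec, hw, mul_one]
  rw [genRayleighFDeriv, hμ, hb, htr, _root_.smul_apply,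
    _root_.sub_apply, _root_.smul_apply, hA.quadFDeriv_single hΩ hy,
    hB.quadFDeriv_single hΩ hy, hquad, hquad, Matrix.mul_sub, Matrix.sub_mul, Matrix.mul_smul, Matrix.smul_mul,
    sub_mulVec, smul_mulVec, dotProduct_sub, dotProduct_smul]
  simp only [smul_eq_mul]
  field_simp

end Derivatives

/-! ### Parametrization of the eigenspace by `V` -/

section Eigenspace

open Matrix

variable {n t : ℕ} {X Y : Matrix (Fin n) (Fin n) ℝ} {V : Matrix (Fin n) (Fin t) ℝ}

/-- `Vᵀ * Y` is a left inverse of `V`. -/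
theorem mulVec_ne_zero_of_orthonormal (hV : Vᵀ * Y * V = 1) {w : Fin t → ℝ} (hw : w ≠ 0) :
    V *ᵥ w ≠ 0 := by
  intro h
  apply hw
  rw [← one_mulVec w, ← hV, ← mulVec_mulVec, h, mulVec_zero]

theorem mulVec_eigenvector {μ : ℝ} (hVeig : X * V = μ • (Y * V)) (w : Fin t → ℝ) :
    X *ᵥ (V *ᵥ w) = μ • Y *ᵥ (V *ᵥ w) := by
  rw [mulVec_mulVec, hVeig, smul_mulVec, mulVec_mulVec]

/-- A `Y`-orthonormal family of eigenvectors, as many as the multiplicity, spans the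
eigenspace. -/
theorem exists_mulVec_eq_of_eigenvector {μ : ℝ} (ht : t = genEigenvalueMultiplicity X Y μ)
    (hVeig : X * V = μ • (Y * V)) (hV : Vᵀ * Y * V = 1) {v : Fin n → ℝ}
    (hv : X *ᵥ v = μ • Y *ᵥ v) : ∃ w, V *ᵥ w = v := by
  have hinj : Function.Injective V.mulVecLin := by
    rw [← LinearMap.ker_eq_bot, LinearMap.ker_eq_bot']
    intro w hw
    by_contra h
    exact mulVec_ne_zero_of_orthonormal hV h hw
  have hle : LinearMap.range V.mulVecLin ≤ LinearMap.ker (X - μ • Y).mulVecLin := by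
    rintro _ ⟨w, rfl⟩
    rw [LinearMap.mem_ker, mulVecLin_apply, mulVecLin_apply, sub_mulVec, smul_mulVec,
      mulVec_eigenvector hVeig, sub_self]
  have heq := Submodule.eq_of_le_of_finrank_eq hle (by
    rw [LinearMap.finrank_range_of_inj hinj, Module.finrank_fin_fun]; exact ht)
  have hmem : v ∈ LinearMap.ker (X - μ • Y).mulVecLin := by
    rw [LinearMap.mem_ker, mulVecLin_apply, sub_mulVec, smul_mulVec, hv, sub_self]
  rw [← heq] at hmem
  exact hmem

end Eigenspace

/-! ### The main theorem -/

theorem theorem3 {m n : ℕ} (hn : 0 < n)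
    (A B : EuclideanSpace ℝ (Fin m) → Matrix (Fin n) (Fin n) ℝ)
    (hA : MatrixC1On A (posOrthant m)) (hB : MatrixC1On B (posOrthant m))
    (hAsymm : ∀ y ∈ posOrthant m, (A y).IsSymm)
    (hBpos : ∀ y ∈ posOrthant m, (B y).PosDef)
    (x : EuclideanSpace ℝ (Fin m)) (hx : x ∈ posOrthant m)
    (t : ℕ) (ht : t = genEigenvalueMultiplicity (A x) (B x) (maxGenEigenvalueFun A B x))
    (V : Matrix (Fin n) (Fin t) ℝ)
    (hVeig : A x * V = maxGenEigenvalueFun A B x • (B x * V))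
    (hVorth : V.transpose * B x * V = 1) :
    LocallyLipschitzOn (posOrthant m) (maxGenEigenvalueFun A B) ∧
    clarkeSubdifferential (maxGenEigenvalueFun A B) x =
      {g | ∃ U ∈ spectraplex t,
        g = WithLp.toLp 2 (fun e : Fin m =>
          (U * (V.transpose *
            (matrixPartialDeriv A x e - maxGenEigenvalueFun A B x • matrixPartialDeriv B x e) *
              V)).trace)} := by
  have hΩ := isOpen_posOrthant m
  -- This is the sphere of the sup norm on `Fin n → ℝ`; any compact set avoiding zero and meeting
  -- every ray would do.
  have hK : IsCompact (Metric.sphere (0 : Fin n → ℝ) 1) := isCompact_sphere _ _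
  have hK0 : ∀ v ∈ Metric.sphere (0 : Fin n → ℝ) 1, v ≠ 0 := fun v hv =>
    ne_zero_of_mem_unit_sphere ⟨v, hv⟩
  have hφ : ∀ y ∈ posOrthant m, ∀ v ∈ Metric.sphere (0 : Fin n → ℝ) 1,
      HasFDerivAt (fun z => genRayleigh (A z) (B z) v) (genRayleighFDeriv A B y v) y :=
    fun y hy v hv => hasFDerivAt_genRayleigh hΩ hA hB hBpos hy (hK0 v hv)
  have hφc := continuousOn_genRayleigh_prod hA hB hBpos
  have hF := continuousOn_genRayleighFDeriv hΩ hA hB hBpos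
  have hmax : ∀ y ∈ posOrthant m, ∃ v ∈ Metric.sphere (0 : Fin n → ℝ) 1,
      genRayleigh (A y) (B y) v = maxGenEigenvalueFun A B y := fun y hy =>
    exists_genRayleigh_eq_maxGenEigenvalue hn (hAsymm y hy) (hBpos y hy)
  have hle : ∀ y ∈ posOrthant m, ∀ v ∈ Metric.sphere (0 : Fin n → ℝ) 1,
      genRayleigh (A y) (B y) v ≤ maxGenEigenvalueFun A B y := fun y hy v hv =>
    genRayleigh_le_maxGenEigenvalue hn (hAsymm y hy) (hBpos y hy) (hK0 v hv)
  refine ⟨locallyLipschitzOn_of_max hΩ hK hφ hF hmax hle, ?_⟩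
  rw [clarkeSubdifferential_max hΩ hK hφ hφc hF hmax hle hx]
  set μ := maxGenEigenvalueFun A B x with hμ
  let L : Matrix (Fin t) (Fin t) ℝ →ₗ[ℝ] EuclideanSpace ℝ (Fin m) :=
    { toFun := fun U => WithLp.toLp 2 fun e => (U * (V.transpose *
        (matrixPartialDeriv A x e - μ • matrixPartialDeriv B x e) * V)).trace
      map_add' := fun U W => by
        ext e; simp [Matrix.add_mul, Matrix.trace_add]
      map_smul' := fun c U => by
        ext e; simp [Matrix.trace_smul] }
  have hgrad : ∀ (c : ℝ) (w : Fin t → ℝ), c ≠ 0 → w ⬝ᵥ w = 1 →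
      genRayleigh (A x) (B x) (c • V.mulVec w) = μ →
      (InnerProductSpace.toDual ℝ (EuclideanSpace ℝ (Fin m))).symm
        (genRayleighFDeriv A B x (c • V.mulVec w)) = L (Matrix.vecMulVec w w) := by
    intro c w hc hw hact
    ext e
    rw [toDual_symm_apply_coord]
    exact genRayleighFDeriv_single hΩ hA hB hx hVorth hw hc hact e
  -- Vectors `v` have sup norm one while `w` is Euclidean-normalized; a nonzero scalar `c` converts
  -- one normalization into the other.
  have himage : (fun v => (InnerProductSpace.toDual ℝ _).symm (genRayleighFDeriv A B x v)) ''
      {v ∈ Metric.sphere (0 : Fin n → ℝ) 1 | genRayleigh (A x) (B x) v = μ} =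
      L '' ((fun w : Fin t → ℝ => Matrix.vecMulVec w w) '' {w | w ⬝ᵥ w = 1}) := by
    ext g
    constructor
    · rintro ⟨v, ⟨hv, hact⟩, rfl⟩
      have heig := eigenvector_of_genRayleigh_max (hAsymm x hx) (hBpos x hx)
        (fun w hw => genRayleigh_le_maxGenEigenvalue hn (hAsymm x hx) (hBpos x hx) hw)
        (hK0 v hv) hact
      obtain ⟨w, rfl⟩ := exists_mulVec_eq_of_eigenvector ht hVeig hVorth heig
      have hw : w ≠ 0 := by
        rintro rfl
        exact hK0 _ hv (Matrix.mulVec_zero V)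
      have hww : 0 < w ⬝ᵥ w := by simpa using Matrix.dotProduct_star_self_pos_iff.2 hw
      have hs := Real.sqrt_pos.2 hww
      have hw' : V.mulVec w = √(w ⬝ᵥ w) • V.mulVec ((√(w ⬝ᵥ w))⁻¹ • w) := by
        rw [Matrix.mulVec_smul, smul_smul, mul_inv_cancel₀ hs.ne', one_smul]
      have hunit : ((√(w ⬝ᵥ w))⁻¹ • w) ⬝ᵥ ((√(w ⬝ᵥ w))⁻¹ • w) = 1 := by
        rw [dotProduct_smul, smul_dotProduct, smul_smul, ← mul_inv, Real.mul_self_sqrt hww.le,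
          smul_eq_mul, inv_mul_cancel₀ hww.ne']
      refine ⟨_, ⟨_, hunit, rfl⟩, ?_⟩
      rw [hw'] at hact
      rw [← hgrad _ _ hs.ne' hunit hact, ← hw']
    · rintro ⟨_, ⟨w, hw, rfl⟩, rfl⟩
      have hw0 : w ≠ 0 := by
        rintro rfl
        simp at hw
      have hVw := mulVec_ne_zero_of_orthonormal hVorth hw0
      have hc := inv_ne_zero (norm_ne_zero_iff.2 hVw)
      have hact : genRayleigh (A x) (B x) (‖V.mulVec w‖⁻¹ • V.mulVec w) = μ := by
        rw [genRayleigh_smul _ _ hc]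
        exact genRayleigh_of_eigenvector (hBpos x hx) hVw (mulVec_eigenvector hVeig w)
      exact ⟨_, ⟨by simp [norm_smul, hVw], hact⟩, hgrad _ w hc hw hact⟩
  -- The linear map `L` commutes with convex hulls.
  rw [himage, ← L.image_convexHull, ← spectraplex_eq_convexHull]
  ext g
  exact ⟨fun ⟨U, hU, h⟩ => ⟨U, hU, h.symm⟩, fun ⟨U, hU, h⟩ => ⟨U, hU, h.symm⟩⟩
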